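/- Let $r(z,\bar z)=\sum_{|\alpha|=|\beta|=m} c_{\alpha,\beta}\,z^\alpha\bar z^\beta$ be a bihomogeneous polynomial of bidegree $(m,m)$ on $\mathbb{C}^n$ that is real-valued, so that its coefficient matrix $(c_{\alpha,\beta})_{|\alpha|=|\beta|=m}$ is Hermitian. Its signature is the pair $(P,N)$, where $P$ and $N$ are the numbers of positive and of negative eigenvalues of this matrix, counted with multiplicity. Write $\|z\|^2=\sum_{j=1}^n|z_j|^2$. We say that $r(z,\bar z)\|z\|^2$ is a squared norm if there are finitely many holomorphic polynomials $h_1,\dots,h_\rho$ on $\mathbb{C}^n$ with $r(z,\bar z)\|z\|^2=\sum_{k=1}^\rho|h_k(z)|^2$ for all $z\in\mathbb{C}^n$. (1) If $n\le 3$, $r$ has signature $(P,1)$, and $r(z,\bar z)\|z\|^2$ is a squared norm, then $P\ge n$. (2) For every $n\ge 4$ there exist $m$, $P$ and a real bihomogeneous polynomial $r(z,\bar z)$ of bidegree $(m,m)$ on $\mathbb{C}^n$ with signature $(P,1)$ such that $r(z,\bar z)\|z\|^2$ is a squared norm and $P<n$. -/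

import Mathlib

open scoped ComplexConjugate

namespace HermitianSOS

/-- Polynomials `r(z, w)` in two groups of `n` variables with complex coefficients. The variable
`Sum.inl j` is `z_j`, and `Sum.inr j` is the variable in whose place `conj z_j` is substituted. -/
abbrev Poly (n : ℕ) : Type := MvPolynomial (Fin n ⊕ Fin n) ℂ

/-- The value `r(z, conj z)`. -/
noncomputable def diagEval {n : ℕ} (r : Poly n) (z : Fin n → ℂ) : ℂ :=
  MvPolynomial.eval (Sum.elim z (fun j => conj (z j))) r

/-- `r` is real: `r(z, conj z)` is a real number for every `z`. -/
def IsReal {n : ℕ} (r : Poly n) : Prop :=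
  ∀ z : Fin n → ℂ, (diagEval r z).im = 0

/-- `r` is bihomogeneous of bidegree `(m, m)`: every monomial that occurs in `r` has degree `m`
in the variables `z` and degree `m` in the variables `conj z`. -/
def IsBihomogeneous {n : ℕ} (r : Poly n) (m : ℕ) : Prop :=
  ∀ s ∈ r.support, ∑ j, s (Sum.inl j) = m ∧ ∑ j, s (Sum.inr j) = m

/-- The multi-indices `α` in `n` variables with `|α| = m`. -/
abbrev MultiIndex (n m : ℕ) : Type :=
  {α : Fin n →₀ ℕ // α ∈ Finset.finsuppAntidiag (Finset.univ : Finset (Fin n)) m}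

/-- The coefficient matrix `(c_{α,β})` with `|α| = |β| = m`, where `c_{α,β}` is the coefficient of
`z^α (conj z)^β` in `r`. -/
noncomputable def coeffMatrix {n : ℕ} (r : Poly n) (m : ℕ) :
    Matrix (MultiIndex n m) (MultiIndex n m) ℂ :=
  Matrix.of fun α β => MvPolynomial.coeff (Finsupp.sumElim α.1 β.1) r

/-- A polynomial that vanishes at all points `(z, conj z)` is zero. -/
theorem eq_zero_of_diagEval {n : ℕ} (q : Poly n) (h : ∀ z, diagEval q z = 0) : q = 0 := by
  let Q : Poly n := MvPolynomial.bind₁ (Sum.elim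
    (fun j => MvPolynomial.X (Sum.inl j) + MvPolynomial.C Complex.I * MvPolynomial.X (Sum.inr j))
    (fun j => MvPolynomial.X (Sum.inl j) - MvPolynomial.C Complex.I * MvPolynomial.X (Sum.inr j))) q
  have hev : ∀ x : Fin n ⊕ Fin n → ℂ, MvPolynomial.eval x Q = MvPolynomial.eval
      (Sum.elim (fun j => x (Sum.inl j) + Complex.I * x (Sum.inr j))
        (fun j => x (Sum.inl j) - Complex.I * x (Sum.inr j))) q := by
    intro x
    have := MvPolynomial.eval₂Hom_bind₁ (RingHom.id ℂ) x (Sum.elim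
      (fun j => MvPolynomial.X (Sum.inl j) + MvPolynomial.C Complex.I * MvPolynomial.X (Sum.inr j))
      (fun j => MvPolynomial.X (Sum.inl j) - MvPolynomial.C Complex.I * MvPolynomial.X (Sum.inr j)))
      q
    refine this.trans ?_
    congr 2
    funext i
    rcases i with j | j <;> simp
  have hQ : Q = 0 := by
    refine MvPolynomial.funext_set (fun _ => Set.range ((↑) : ℝ → ℂ))
      (fun _ => Set.infinite_range_of_injective Complex.ofReal_injective) fun x hx => ?_
    choose y hy using fun i => hx i (Set.mem_univ i)
    rw [hev, map_zero, ← h (fun j => x (Sum.inl j) + Complex.I * x (Sum.inr j)), diagEval]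
    congr 2
    funext i
    rcases i with j | j
    · rfl
    · simp [← hy, sub_eq_add_neg]
  refine MvPolynomial.funext fun x => ?_
  have h1 := hev (Sum.elim (fun j => (x (Sum.inl j) + x (Sum.inr j)) / 2)
    (fun j => -Complex.I * ((x (Sum.inl j) - x (Sum.inr j)) / 2)))
  rw [hQ, map_zero] at h1
  rw [map_zero, h1]
  congr 2
  funext i
  rcases i with j | j
  · simp only [Sum.elim_inl, Sum.elim_inr]
    linear_combination (-(x (Sum.inl j) - x (Sum.inr j)) / 2) * (-Complex.I_mul_I)
  · simp only [Sum.elim_inl, Sum.elim_inr]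
    linear_combination ((x (Sum.inl j) - x (Sum.inr j)) / 2) * (-Complex.I_mul_I)

/-- The coefficient matrix of a real polynomial is Hermitian. -/
theorem coeffMatrix_isHermitian {n : ℕ} {r : Poly n} (hr : IsReal r) (m : ℕ) :
    (coeffMatrix r m).IsHermitian := by
  let t : Poly n := MvPolynomial.rename Sum.swap (MvPolynomial.map (starRingEnd ℂ) r)
  have ht : r = t := by
    refine sub_eq_zero.mp (eq_zero_of_diagEval _ fun z => ?_)
    have h1 : diagEval t z = conj (diagEval r z) := by
      simp only [diagEval, t, MvPolynomial.eval_rename, MvPolynomial.eval_map]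
      rw [← MvPolynomial.eval₂_id, MvPolynomial.hom_eval₂]
      congr 1
      funext i
      rcases i with j | j <;> simp
    have h2 : diagEval (r - t) z = diagEval r z - diagEval t z := by
      simp [diagEval]
    rw [h2, h1, Complex.conj_eq_iff_im.mpr (hr z), sub_self]
  ext α β
  simp only [Matrix.conjTranspose_apply, coeffMatrix, Matrix.of_apply]
  have h3 : Finsupp.sumElim α.1 β.1 = (Finsupp.sumElim β.1 α.1).mapDomain Sum.swap := by
    have : (Sum.swap : Fin n ⊕ Fin n → _) = Equiv.sumComm (Fin n) (Fin n) := rfl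
    rw [this]
    ext i
    rw [Finsupp.mapDomain_equiv_apply]
    rcases i with j | j <;> simp
  conv_rhs => rw [ht]
  rw [h3, MvPolynomial.coeff_rename_mapDomain _ Sum.swap_leftInverse.injective,
    MvPolynomial.coeff_map]
  rfl

/-- The signature of a Hermitian matrix: the numbers of its positive and of its negative
eigenvalues, counted with multiplicity. -/
noncomputable def signature {ι : Type*} [Fintype ι] [DecidableEq ι] {A : Matrix ι ι ℂ}
    (hA : A.IsHermitian) : ℕ × ℕ :=
  (Nat.card {i // 0 < hA.eigenvalues i}, Nat.card {i // hA.eigenvalues i < 0})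

/-- `F` is a squared norm: `F(z) = |h_1(z)|² + ⋯ + |h_ρ(z)|²` on `ℂⁿ` for a holomorphic polynomial
mapping `h = (h_1, …, h_ρ)`. -/
def IsSquaredNorm {n : ℕ} (F : (Fin n → ℂ) → ℂ) : Prop :=
  ∃ (ρ : ℕ) (h : Fin ρ → MvPolynomial (Fin n) ℂ),
    ∀ z, F z = ((∑ k, ‖MvPolynomial.eval z (h k)‖ ^ 2 : ℝ) : ℂ)

end HermitianSOS

/-! Diagonalising the coefficient matrix writes r as a real combination of |f|² over eigenvector
forms f. Let I be the ideal generated by those with positive eigenvalue, and g the form with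
negative eigenvalue. If a linear functional l killed I but not z_j g, then l ⊗ conj l would be
negative on r‖z‖², yet it is nonnegative on every squared norm. So z_j g ∈ I for all j
(`X_mul_eigenform_mem_span`): g represents a socle element modulo I. With fewer than n ≤ 3
generators the quotient has no socle (`mem_span_of_forall_X_mul_mem`), so g ∈ I. As all the forms
have degree m, g is then a linear combination of the others, against independence of eigenvectors.

For n ≥ 4, n - 1 generators can leave a socle. Take f's x³, xy², x(ax+by), w_i xy and g = x²y. Then
xg = y·x³, yg = x·xy², ag = y·x(ax+by) - b·xy², bg = x·x(ax+by) - a·x³ and w_i g = x·w_i xy. In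
(2∑|f_i|² - |g|²)‖z‖² the negative terms are absorbed through 2|u|² + 2|v|² - |u-v|² = |u+v|². The
signature follows from a dimension count (`card_pos_eigenvalues_le`). -/

namespace HermitianSOS

/-! ### Socles modulo ideals with few generators. -/

section Koszul

variable {σ : Type*} {i j k : σ}

open MvPolynomial

theorem exists_eq_X_mul_of_X_mul_eq (hij : i ≠ j) {a b : MvPolynomial σ ℂ}
    (h : X i * a = X j * b) : ∃ c, a = X j * c ∧ b = X i * c := by
  have hp : Prime (X j : MvPolynomial σ ℂ) := X_prime
  have hd : (X j : MvPolynomial σ ℂ) ∣ X i * a := ⟨b, h⟩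
  rcases hp.dvd_or_dvd hd with h1 | ⟨c, rfl⟩
  · exact absurd (X_dvd_X.mp h1).symm (by simpa using hij)
  · exact ⟨c, rfl, mul_left_cancel₀ (X_ne_zero j) (by rw [← h]; ring)⟩

theorem dvd_of_dvd_X_mul (hij : i ≠ j) {f g : MvPolynomial σ ℂ}
    (hi : f ∣ X i * g) (hj : f ∣ X j * g) : f ∣ g := by
  rcases eq_or_ne f 0 with rfl | hf
  · simpa [X_ne_zero] using hi
  obtain ⟨u, hu⟩ := hi
  obtain ⟨v, hv⟩ := hj
  obtain ⟨c, hc, -⟩ := exists_eq_X_mul_of_X_mul_eq hij.symm (a := u) (b := v)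
    (mul_left_cancel₀ hf (by linear_combination X i * hv - X j * hu))
  exact ⟨c, mul_left_cancel₀ (X_ne_zero i) (by rw [hu, hc]; ring)⟩

/-- The Koszul complex of three variables is exact in the middle. -/
theorem exists_koszul_preimage (hij : i ≠ j) (hik : i ≠ k) (hjk : j ≠ k)
    {a b c : MvPolynomial σ ℂ} (h : X i * a + X j * b + X k * c = 0) :
    ∃ p q s, a = X j * s - X k * q ∧ b = X k * p - X i * s ∧ c = X i * q - X j * p := by
  -- Modulo the monomial ideal (X i, X j), multiplication by X k is injective.
  have hc : c ∈ Ideal.span (X '' ({i, j} : Set σ) : Set (MvPolynomial σ ℂ)) := by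
    rw [mem_ideal_span_X_image]
    intro m hm
    have h1 : X k * c ∈ Ideal.span (X '' ({i, j} : Set σ) : Set (MvPolynomial σ ℂ)) := by
      rw [show X k * c = (-a) * X i + (-b) * X j by linear_combination h]
      exact add_mem (Ideal.mul_mem_left _ _ (Ideal.subset_span ⟨i, by simp, rfl⟩))
        (Ideal.mul_mem_left _ _ (Ideal.subset_span ⟨j, by simp, rfl⟩))
    rw [mem_ideal_span_X_image] at h1
    obtain ⟨l, hl, hl'⟩ := h1 (Finsupp.single k 1 + m) (by
      rw [mem_support_iff, coeff_X_mul]; exact mem_support_iff.mp hm)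
    refine ⟨l, hl, ?_⟩
    have hkl : k ≠ l := by rintro rfl; rcases hl with rfl | rfl <;> simp_all
    simpa [Finsupp.single_apply, hkl] using hl'
  rw [Set.image_pair, Ideal.mem_span_pair] at hc
  obtain ⟨q, p, rfl⟩ := hc
  obtain ⟨s, hs, hs'⟩ := exists_eq_X_mul_of_X_mul_eq hij (a := a + X k * q) (b := -b - X k * p)
    (by linear_combination h)
  exact ⟨-p, q, s, by linear_combination hs, by linear_combination -hs', by ring⟩

/-- Once the gcd is divided out, the two generators a, b have only the trivial syzygy (b, -a). The
representations of X i * g, X j * g, X k * g therefore differ from a compatible family by a Koszul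
cycle; exactness corrects them, and the variable cancels. -/
theorem mem_span_pair_of_X_mul_mem_of_ne_zero (hij : i ≠ j) (hik : i ≠ k) (hjk : j ≠ k)
    {f₁ f₂ g : MvPolynomial σ ℂ} (hf : f₁ ≠ 0)
    (hi : X i * g ∈ Ideal.span {f₁, f₂}) (hj : X j * g ∈ Ideal.span {f₁, f₂})
    (hk : X k * g ∈ Ideal.span {f₁, f₂}) : g ∈ Ideal.span {f₁, f₂} := by
  obtain ⟨a, b, d, hab, rfl, rfl⟩ := UniqueFactorizationMonoid.exists_reduced_factors f₁ hf f₂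
  have hd : d ≠ 0 := left_ne_zero_of_mul hf
  have ha : a ≠ 0 := right_ne_zero_of_mul hf
  rw [Ideal.mem_span_pair] at hi hj hk
  obtain ⟨ui, vi, hi⟩ := hi
  obtain ⟨uj, vj, hj⟩ := hj
  obtain ⟨uk, vk, hk⟩ := hk
  obtain ⟨g, rfl⟩ : d ∣ g := dvd_of_dvd_X_mul hij
    ⟨ui * a + vi * b, by rw [← hi]; ring⟩ ⟨uj * a + vj * b, by rw [← hj]; ring⟩
  replace hi : ui * a + vi * b = X i * g := mul_left_cancel₀ hd (by linear_combination hi)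
  replace hj : uj * a + vj * b = X j * g := mul_left_cancel₀ hd (by linear_combination hj)
  replace hk : uk * a + vk * b = X k * g := mul_left_cancel₀ hd (by linear_combination hk)
  -- Eliminating g between two of the representations gives a syzygy of (a, b), whose second entry
  -- must be divisible by a.
  obtain ⟨ei, hei⟩ : a ∣ X k * vj - X j * vk := hab.dvd_of_dvd_mul_left
    ⟨X j * uk - X k * uj, by linear_combination X k * hj - X j * hk⟩
  obtain ⟨ej, hej⟩ : a ∣ X i * vk - X k * vi := hab.dvd_of_dvd_mul_left
    ⟨X k * ui - X i * uk, by linear_combination X i * hk - X k * hi⟩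
  obtain ⟨ek, hek⟩ : a ∣ X j * vi - X i * vj := hab.dvd_of_dvd_mul_left
    ⟨X i * uj - X j * ui, by linear_combination X j * hi - X i * hj⟩
  obtain ⟨p, q, s, rfl, rfl, rfl⟩ := exists_koszul_preimage hij hik hjk
    (a := ei) (b := ej) (c := ek)
    (mul_left_cancel₀ ha (by linear_combination -X i * hei - X j * hej - X k * hek))
  -- After correction by q and s, the coefficients for X j and X k are X j and X k times common
  -- polynomials c and e, so g = e * a + c * b up to the factor d.
  obtain ⟨c, hc, -⟩ := exists_eq_X_mul_of_X_mul_eq hjk.symm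
    (a := vj + a * q) (b := vk + a * s) (by linear_combination hei)
  obtain ⟨e, he, -⟩ := exists_eq_X_mul_of_X_mul_eq hjk.symm
    (a := uj - b * q) (b := uk - b * s) (mul_left_cancel₀ ha (by
      linear_combination -b * hei + X k * hj - X j * hk))
  rw [Ideal.mem_span_pair]
  refine ⟨e, c, mul_left_cancel₀ (X_ne_zero j) ?_⟩
  linear_combination -d * a * he - d * b * hc + d * hj

theorem mem_span_pair_of_X_mul_mem (hij : i ≠ j) (hik : i ≠ k) (hjk : j ≠ k)
    {f₁ f₂ g : MvPolynomial σ ℂ}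
    (hi : X i * g ∈ Ideal.span {f₁, f₂}) (hj : X j * g ∈ Ideal.span {f₁, f₂})
    (hk : X k * g ∈ Ideal.span {f₁, f₂}) : g ∈ Ideal.span {f₁, f₂} := by
  rcases eq_or_ne f₁ 0 with rfl | h1
  · rcases eq_or_ne f₂ 0 with rfl | h2
    · simpa [X_ne_zero] using hi
    · rw [Set.pair_comm] at *
      exact mem_span_pair_of_X_mul_mem_of_ne_zero hij hik hjk h2 hi hj hk
  · exact mem_span_pair_of_X_mul_mem_of_ne_zero hij hik hjk h1 hi hj hk

/-- In at most three variables, a quotient by fewer polynomials than there are variables has no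
socle at the origin. -/
theorem mem_span_of_forall_X_mul_mem {n : ℕ} (hn : n ≤ 3) {S : Set (MvPolynomial (Fin n) ℂ)}
    (hS : S.Finite) (hSn : S.ncard < n) {g : MvPolynomial (Fin n) ℂ}
    (hg : ∀ j, X j * g ∈ Ideal.span S) : g ∈ Ideal.span S := by
  interval_cases n
  · omega
  · obtain rfl : S = ∅ := (Set.ncard_eq_zero hS).mp (by omega)
    simpa [X_ne_zero] using hg 0
  · rcases Nat.lt_succ_iff_lt_or_eq.mp hSn with h | h
    · obtain rfl : S = ∅ := (Set.ncard_eq_zero hS).mp (by omega)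
      simpa [X_ne_zero] using hg 0
    · obtain ⟨f, rfl⟩ := Set.ncard_eq_one.mp h
      simp only [Ideal.mem_span_singleton] at hg ⊢
      exact dvd_of_dvd_X_mul (by decide) (hg 0) (hg 1)
  · rcases Nat.lt_succ_iff_lt_or_eq.mp hSn with h | h
    · rcases Nat.lt_succ_iff_lt_or_eq.mp h with h | h
      · obtain rfl : S = ∅ := (Set.ncard_eq_zero hS).mp (by omega)
        simpa [X_ne_zero] using hg 0
      · obtain ⟨f, rfl⟩ := Set.ncard_eq_one.mp h
        simp only [Ideal.mem_span_singleton] at hg ⊢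
        exact dvd_of_dvd_X_mul (by decide) (hg 0) (hg 1)
    · obtain ⟨f₁, f₂, -, rfl⟩ := Set.ncard_eq_two.mp h
      exact mem_span_pair_of_X_mul_mem (by decide) (by decide) (by decide) (hg 0) (hg 1) (hg 2)

/-- A form in the ideal generated by forms of the same degree is a linear combination of them. -/
theorem mem_submodule_span_of_mem_ideal_span {m : ℕ} {S : Set (MvPolynomial σ ℂ)}
    (hS : ∀ f ∈ S, f.IsHomogeneous m) {g : MvPolynomial σ ℂ} (hg : g.IsHomogeneous m)
    (h : g ∈ Ideal.span S) : g ∈ Submodule.span ℂ S := by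
  -- Taking degree-m components leaves only the constant terms of the multipliers.
  have key : ∀ a, ∀ f ∈ S, homogeneousComponent m (a * f) ∈ Submodule.span ℂ S := by
    intro a f hf
    induction a using MvPolynomial.induction_on' with
    | add p q hp hq => rw [add_mul, map_add]; exact add_mem hp hq
    | monomial s c =>
      rw [homogeneousComponent_of_mem ((isHomogeneous_monomial c rfl).mul (hS f hf))]
      split_ifs with hs
      · obtain rfl : s = 0 := (Finsupp.degree_eq_zero_iff s).mp (by omega)
        rw [← C_apply, ← smul_eq_C_mul]
        exact Submodule.smul_mem _ _ (Submodule.subset_span hf)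
      · exact zero_mem _
  obtain ⟨N, a, f, rfl⟩ := Submodule.mem_span_set'.mp h
  rw [← homogeneousComponent_eq_self hg, map_sum]
  exact sum_mem fun l _ => key _ _ (f l).2

end Koszul

/-! ### Hermitian products and functionals on them. -/

open MvPolynomial

variable {n m : ℕ}

/-- The polynomial `p(z) * conj q(z)`. -/
noncomputable def hermProd (p q : MvPolynomial (Fin n) ℂ) : Poly n :=
  rename Sum.inl p * rename Sum.inr (map (starRingEnd ℂ) q)

theorem diagEval_hermProd (p q : MvPolynomial (Fin n) ℂ) (z : Fin n → ℂ) :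
    diagEval (hermProd p q) z = eval z p * conj (eval z q) := by
  simp only [diagEval, hermProd, map_mul, eval_rename, eval_map, Sum.elim_comp_inl,
    Sum.elim_comp_inr]
  rw [← eval₂_id (p := q), hom_eval₂]
  rfl

theorem diagEval_hermProd_self (p : MvPolynomial (Fin n) ℂ) (z : Fin n → ℂ) :
    diagEval (hermProd p p) z = ((‖eval z p‖ ^ 2 : ℝ) : ℂ) := by
  rw [diagEval_hermProd, Complex.mul_conj, Complex.normSq_eq_norm_sq]

theorem hermProd_add_left (p₁ p₂ q : MvPolynomial (Fin n) ℂ) :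
    hermProd (p₁ + p₂) q = hermProd p₁ q + hermProd p₂ q := by
  simp only [hermProd, map_add, add_mul]

theorem hermProd_add_right (p q₁ q₂ : MvPolynomial (Fin n) ℂ) :
    hermProd p (q₁ + q₂) = hermProd p q₁ + hermProd p q₂ := by
  simp only [hermProd, map_add, mul_add]

theorem hermProd_mul_mul (p₁ p₂ q₁ q₂ : MvPolynomial (Fin n) ℂ) :
    hermProd (p₁ * p₂) (q₁ * q₂) = hermProd p₁ q₁ * hermProd p₂ q₂ := by
  simp only [hermProd, map_mul]; ring

theorem mapDomain_inl_add_mapDomain_inr (s t : Fin n →₀ ℕ) :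
    s.mapDomain Sum.inl + t.mapDomain Sum.inr = s.sumElim t := by
  ext (j | j)
  · simp [Finsupp.mapDomain_apply Sum.inl_injective, Finsupp.mapDomain_of_notMem_range]
  · simp [Finsupp.mapDomain_apply Sum.inr_injective, Finsupp.mapDomain_of_notMem_range]

theorem hermProd_monomial (s t : Fin n →₀ ℕ) (a b : ℂ) :
    hermProd (monomial s a) (monomial t b) = monomial (s.sumElim t) (a * conj b) := by
  rw [hermProd, rename_monomial, map_monomial, rename_monomial, monomial_mul,
    mapDomain_inl_add_mapDomain_inr]

theorem sumElim_inj {s s' t t' : Fin n →₀ ℕ} :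
    s.sumElim t = s'.sumElim t' ↔ s = s' ∧ t = t' := by
  refine ⟨fun h => ⟨?_, ?_⟩, by rintro ⟨rfl, rfl⟩; rfl⟩
  · ext j; simpa using DFunLike.congr_fun h (Sum.inl j)
  · ext j; simpa using DFunLike.congr_fun h (Sum.inr j)

theorem exists_eq_sumElim (u : Fin n ⊕ Fin n →₀ ℕ) : ∃ s t, u = Finsupp.sumElim s t :=
  ⟨u.comapDomain Sum.inl Sum.inl_injective.injOn, u.comapDomain Sum.inr Sum.inr_injective.injOn,
    by ext (j | j) <;> simp⟩

theorem coeff_hermProd (p q : MvPolynomial (Fin n) ℂ) (s t : Fin n →₀ ℕ) :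
    coeff (s.sumElim t) (hermProd p q) = coeff s p * conj (coeff t q) := by
  induction p using MvPolynomial.induction_on' with
  | add p₁ p₂ h₁ h₂ => rw [hermProd_add_left, coeff_add, h₁, h₂, coeff_add, add_mul]
  | monomial u a =>
    induction q using MvPolynomial.induction_on' with
    | add q₁ q₂ h₁ h₂ => rw [hermProd_add_right, coeff_add, h₁, h₂, coeff_add, map_add, mul_add]
    | monomial v b =>
      simp only [hermProd_monomial, coeff_monomial, sumElim_inj]
      by_cases h1 : u = s <;> by_cases h2 : v = t <;> simp [h1, h2]

/-- A linear functional `ℓ` induces the functional `p(z) * conj q(z) ↦ ℓ p * conj (ℓ q)`. -/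
noncomputable def dualForm (l : MvPolynomial (Fin n) ℂ →ₗ[ℂ] ℂ) : Poly n →ₗ[ℂ] ℂ :=
  (basisMonomials (Fin n ⊕ Fin n) ℂ).constr ℂ fun u =>
    l (monomial (u.comapDomain Sum.inl Sum.inl_injective.injOn) 1) *
      conj (l (monomial (u.comapDomain Sum.inr Sum.inr_injective.injOn) 1))

theorem dualForm_hermProd (l : MvPolynomial (Fin n) ℂ →ₗ[ℂ] ℂ) (p q : MvPolynomial (Fin n) ℂ) :
    dualForm l (hermProd p q) = l p * conj (l q) := by
  induction p using MvPolynomial.induction_on' with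
  | add p₁ p₂ h₁ h₂ => rw [hermProd_add_left, map_add, h₁, h₂, map_add, add_mul]
  | monomial s a =>
    induction q using MvPolynomial.induction_on' with
    | add q₁ q₂ h₁ h₂ => rw [hermProd_add_right, map_add, h₁, h₂, map_add, map_add, mul_add]
    | monomial t b =>
      have h1 : ∀ (σ : Type) (u : σ →₀ ℕ) (c : ℂ), monomial u c = c • monomial u 1 := by
        intro σ u c; simp [smul_monomial]
      have h2 := (basisMonomials (Fin n ⊕ Fin n) ℂ).constr_basis ℂ (fun u =>
        l (monomial (u.comapDomain Sum.inl Sum.inl_injective.injOn) 1) *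
          conj (l (monomial (u.comapDomain Sum.inr Sum.inr_injective.injOn) 1))) (s.sumElim t)
      rw [coe_basisMonomials, Finsupp.comapDomain_inl_sumElim,
        Finsupp.comapDomain_inr_sumElim] at h2
      rw [hermProd_monomial, h1, h1 _ s, h1 _ t, map_smul, map_smul, map_smul, dualForm, h2]
      simp only [smul_eq_mul, map_mul]
      ring

theorem dualForm_hermProd_self (l : MvPolynomial (Fin n) ℂ →ₗ[ℂ] ℂ) (p : MvPolynomial (Fin n) ℂ) :
    dualForm l (hermProd p p) = ((‖l p‖ ^ 2 : ℝ) : ℂ) := by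
  rw [dualForm_hermProd, Complex.mul_conj, Complex.normSq_eq_norm_sq]

/-! ### Spectral decomposition of r and the case n ≤ 3. -/

/-- The form of degree `m` with coefficient vector `v`. -/
noncomputable def formOfCoeffs (n m : ℕ) : (MultiIndex n m → ℂ) →ₗ[ℂ] MvPolynomial (Fin n) ℂ where
  toFun v := ∑ α, monomial α.1 (v α)
  map_add' v w := by simp [Finset.sum_add_distrib]
  map_smul' c v := by simp [Finset.smul_sum, smul_monomial]

theorem formOfCoeffs_apply (v : MultiIndex n m → ℂ) :
    formOfCoeffs n m v = ∑ α, monomial α.1 (v α) := rfl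

theorem coeff_formOfCoeffs (v : MultiIndex n m → ℂ) (α : MultiIndex n m) :
    coeff α.1 (formOfCoeffs n m v) = v α := by
  simp [formOfCoeffs_apply, coeff_sum, coeff_monomial]

theorem formOfCoeffs_injective : Function.Injective (formOfCoeffs n m) := fun v w h =>
  funext fun α => by rw [← coeff_formOfCoeffs v, h, coeff_formOfCoeffs]

theorem isHomogeneous_formOfCoeffs (v : MultiIndex n m → ℂ) :
    (formOfCoeffs n m v).IsHomogeneous m :=
  IsHomogeneous.sum _ _ _ fun α _ => isHomogeneous_monomial _ (by
    have := (Finset.mem_finsuppAntidiag.mp α.2).1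
    rw [Finsupp.degree_eq_sum]; exact this)

theorem coeff_formOfCoeffs_of_sum_ne (v : MultiIndex n m → ℂ) {s : Fin n →₀ ℕ}
    (hs : ∑ j, s j ≠ m) : coeff s (formOfCoeffs n m v) = 0 :=
  (isHomogeneous_formOfCoeffs v).coeff_eq_zero (by rwa [Finsupp.degree_eq_sum])

/-- The form of degree `m` whose coefficients are those of an eigenvector. -/
noncomputable def eigenform {A : Matrix (MultiIndex n m) (MultiIndex n m) ℂ} (hA : A.IsHermitian)
    (k : MultiIndex n m) : MvPolynomial (Fin n) ℂ :=
  formOfCoeffs n m (hA.eigenvectorBasis k)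

theorem eigenform_notMem_span {A : Matrix (MultiIndex n m) (MultiIndex n m) ℂ}
    (hA : A.IsHermitian) {K : Set (MultiIndex n m)} {k : MultiIndex n m} (hk : k ∉ K) :
    eigenform hA k ∉ Submodule.span ℂ (eigenform hA '' K) := by
  have h1 : LinearIndependent ℂ (eigenform hA) := by
    have := hA.eigenvectorBasis.orthonormal.linearIndependent
    exact this.map' (formOfCoeffs n m ∘ₗ (WithLp.linearEquiv 2 ℂ (MultiIndex n m → ℂ)).toLinearMap)
      (LinearMap.ker_eq_bot.mpr (formOfCoeffs_injective.comp (LinearEquiv.injective _)))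
  exact h1.notMem_span_image hk

theorem apply_eq_sum_eigenvalues {ι : Type*} [Fintype ι] [DecidableEq ι] {A : Matrix ι ι ℂ}
    (hA : A.IsHermitian) (α β : ι) : A α β = ∑ k, (hA.eigenvalues k : ℂ) *
      (hA.eigenvectorBasis k α * conj (hA.eigenvectorBasis k β)) := by
  conv_lhs => rw [hA.spectral_theorem, Unitary.conjStarAlgAut_apply]
  rw [Matrix.mul_apply]
  refine Finset.sum_congr rfl fun k _ => ?_
  rw [Matrix.mul_diagonal, Matrix.star_apply, Matrix.IsHermitian.eigenvectorUnitary_apply,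
    Matrix.IsHermitian.eigenvectorUnitary_apply]
  simp
  ring

theorem eq_sum_eigenvalues_hermProd {r : Poly n} (hr : IsReal r) (hb : IsBihomogeneous r m) :
    r = ∑ k, C ((coeffMatrix_isHermitian hr m).eigenvalues k : ℂ) *
      hermProd (eigenform (coeffMatrix_isHermitian hr m) k)
        (eigenform (coeffMatrix_isHermitian hr m) k) := by
  ext u
  obtain ⟨s, t, rfl⟩ := exists_eq_sumElim u
  simp only [coeff_sum, coeff_C_mul, coeff_hermProd]
  by_cases hs : ∑ j, s j = m
  · by_cases ht : ∑ j, t j = m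
    · let α : MultiIndex n m := ⟨s, Finset.mem_finsuppAntidiag.mpr ⟨hs, by simp⟩⟩
      let β : MultiIndex n m := ⟨t, Finset.mem_finsuppAntidiag.mpr ⟨ht, by simp⟩⟩
      refine (apply_eq_sum_eigenvalues (coeffMatrix_isHermitian hr m) α β).trans
        (Finset.sum_congr rfl fun k _ => ?_)
      have h1 := coeff_formOfCoeffs ((coeffMatrix_isHermitian hr m).eigenvectorBasis k) α
      have h2 := coeff_formOfCoeffs ((coeffMatrix_isHermitian hr m).eigenvectorBasis k) β
      rw [← h1, ← h2]
      rfl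
    · simp only [eigenform, coeff_formOfCoeffs_of_sum_ne _ ht, map_zero, mul_zero,
        Finset.sum_const_zero]
      by_contra h
      exact ht (by simpa using (hb _ (mem_support_iff.mpr h)).2)
  · simp only [eigenform, coeff_formOfCoeffs_of_sum_ne _ hs, zero_mul, mul_zero,
      Finset.sum_const_zero]
    by_contra h
    exact hs (by simpa using (hb _ (mem_support_iff.mpr h)).1)

/-- A functional separating X j * g from the ideal would make `dualForm` negative on a sum of terms
|h_k|², where it equals ∑ |l(h_k)|². -/
theorem X_mul_eigenform_mem_span {r : Poly n} (hr : IsReal r) (hb : IsBihomogeneous r m)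
    (hsq : IsSquaredNorm fun z => diagEval r z * ((∑ j, ‖z j‖ ^ 2 : ℝ) : ℂ))
    {k : MultiIndex n m} (hk : (coeffMatrix_isHermitian hr m).eigenvalues k < 0) (j : Fin n) :
    X j * eigenform (coeffMatrix_isHermitian hr m) k ∈
      Ideal.span (eigenform (coeffMatrix_isHermitian hr m) ''
        {i | 0 < (coeffMatrix_isHermitian hr m).eigenvalues i}) := by
  set hA := coeffMatrix_isHermitian hr m
  set I := Ideal.span (eigenform hA '' {i | 0 < hA.eigenvalues i}) with hI
  by_contra hmem
  obtain ⟨l, hl, hlI⟩ := Submodule.exists_le_ker_of_notMem (p := I.restrictScalars ℂ) hmem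
  obtain ⟨ρ, h, hh⟩ := hsq
  -- The identity must hold between polynomials in independent z and conj z before `dualForm` can be
  -- applied.
  have hpoly : r * ∑ i, hermProd (X i) (X i) = ∑ k, hermProd (h k) (h k) := by
    refine sub_eq_zero.mp (eq_zero_of_diagEval _ fun z => ?_)
    have h1 := hh z
    simp only [Complex.ofReal_sum] at h1
    have h2 : ∀ p : MvPolynomial (Fin n) ℂ, eval (Sum.elim z fun j => conj (z j)) (hermProd p p) =
      ((‖eval z p‖ ^ 2 : ℝ) : ℂ) := fun p => diagEval_hermProd_self p z
    simp only [diagEval, map_sub, map_mul, map_sum, h2, eval_X, sub_eq_zero] at h1 ⊢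
    exact h1
  have hval := congrArg (fun p => (dualForm l p).re) hpoly
  have hL : r * ∑ i, hermProd (X i) (X i) = ∑ a, ∑ i, (hA.eigenvalues a : ℂ) •
      hermProd (X i * eigenform hA a) (X i * eigenform hA a) := by
    conv_lhs => rw [eq_sum_eigenvalues_hermProd hr hb]
    rw [Finset.sum_mul_sum]
    refine Finset.sum_congr rfl fun a _ => Finset.sum_congr rfl fun i _ => ?_
    rw [hermProd_mul_mul, smul_eq_C_mul]
    ring
  rw [hL] at hval
  simp only [map_sum, map_smul, dualForm_hermProd_self, smul_eq_mul, ← Complex.ofReal_mul,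
    Complex.re_sum, Complex.ofReal_re] at hval
  -- Terms with positive eigenvalue vanish since l kills the ideal; the term at k and j is strictly
  -- negative.
  have hneg : ∑ a, ∑ i, hA.eigenvalues a * ‖l (X i * eigenform hA a)‖ ^ 2 < 0 := by
    have hle : ∀ a i, hA.eigenvalues a * ‖l (X i * eigenform hA a)‖ ^ 2 ≤ 0 := by
      intro a i
      rcases le_or_gt (hA.eigenvalues a) 0 with h0 | h0
      · exact mul_nonpos_of_nonpos_of_nonneg h0 (sq_nonneg _)
      · have : l (X i * eigenform hA a) = 0 :=
          hlI (I.mul_mem_left _ (Ideal.subset_span ⟨a, h0, rfl⟩))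
        simp [this]
    refine Finset.sum_neg' (fun a _ => Finset.sum_nonpos fun i _ => hle a i)
      ⟨k, Finset.mem_univ _, Finset.sum_neg' (fun i _ => hle k i) ⟨j, Finset.mem_univ _, ?_⟩⟩
    exact mul_neg_of_neg_of_pos hk (pow_pos (norm_pos_iff.mpr hl) 2)
  rw [hval] at hneg
  exact hneg.not_ge (Finset.sum_nonneg fun _ _ => sq_nonneg _)

theorem le_of_isSquaredNorm_mul {P : ℕ} {r : Poly n} (hr : IsReal r) (hb : IsBihomogeneous r m)
    (hsig : signature (coeffMatrix_isHermitian hr m) = (P, 1))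
    (hsq : IsSquaredNorm fun z => diagEval r z * ((∑ j, ‖z j‖ ^ 2 : ℝ) : ℂ)) (hn : n ≤ 3) :
    n ≤ P := by
  set hA := coeffMatrix_isHermitian hr m with hAdef
  obtain ⟨hP, hN⟩ := Prod.mk.inj hsig
  obtain ⟨⟨k, hk⟩⟩ : Nonempty {i // hA.eigenvalues i < 0} := by
    by_contra h
    rw [not_nonempty_iff] at h
    simp at hN
  by_contra! hPn
  set K := {i | 0 < hA.eigenvalues i}
  refine eigenform_notMem_span hA (K := K) (k := k) (fun h => lt_asymm hk h)
    (mem_submodule_span_of_mem_ideal_span (m := m) ?_ (isHomogeneous_formOfCoeffs _)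
      (mem_span_of_forall_X_mul_mem hn (K.toFinite.image _) ?_
        fun j => X_mul_eigenform_mem_span hr hb hsq hk j))
  · rintro _ ⟨i, -, rfl⟩
    exact isHomogeneous_formOfCoeffs _
  · refine (Set.ncard_image_le K.toFinite).trans_lt ?_
    rwa [← Nat.card_coe_set_eq, show Nat.card K = P from hP]


/-! ### Bounding the number of eigenvalues of a given sign. -/

open scoped Matrix in
theorem dotProduct_mulVec_eq_sum {ι κ : Type*} [Fintype ι] [Fintype κ] {A : Matrix ι ι ℂ}
    {d : κ → ℝ} {v : κ → ι → ℂ}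
    (hA : ∀ α β, A α β = ∑ k, (d k : ℂ) * (v k α * conj (v k β))) (x : ι → ℂ) :
    star x ⬝ᵥ A *ᵥ x = ((∑ k, d k * ‖star (v k) ⬝ᵥ x‖ ^ 2 : ℝ) : ℂ) := by
  have h : ∀ k, ((d k * ‖star (v k) ⬝ᵥ x‖ ^ 2 : ℝ) : ℂ) =
      ∑ α, ∑ β, conj (x α) * ((d k : ℂ) * (v k α * conj (v k β)) * x β) := by
    intro k
    have h1 : ∑ α, conj (x α) * v k α = conj (star (v k) ⬝ᵥ x) := by
      simp [dotProduct, mul_comm]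
    have h2 : ∑ β, conj (v k β) * x β = star (v k) ⬝ᵥ x := rfl
    rw [Complex.ofReal_mul, ← Complex.normSq_eq_norm_sq, Complex.normSq_eq_conj_mul_self, ← h1,
      ← h2, Finset.sum_mul_sum, Finset.mul_sum]
    refine Finset.sum_congr rfl fun α _ => ?_
    rw [Finset.mul_sum]
    exact Finset.sum_congr rfl fun β _ => by ring
  rw [Complex.ofReal_sum, Finset.sum_congr rfl fun k _ => h k, Finset.sum_comm]
  refine Finset.sum_congr rfl fun α _ => ?_
  rw [Finset.sum_comm]
  simp only [Pi.star_apply, RCLike.star_def, Matrix.mulVec, dotProduct, Finset.mul_sum]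
  refine Finset.sum_congr rfl fun β _ => ?_
  rw [hA, Finset.sum_mul, Finset.mul_sum]

open scoped Matrix in
/-- If a multiple of a Hermitian form is nonpositive on a subspace of codimension at most `d`, then
that multiple has at most `d` positive eigenvalues. -/
theorem card_pos_eigenvalues_le {ι κ : Type*} [Fintype ι] [DecidableEq ι] [Fintype κ]
    {A : Matrix ι ι ℂ} (hA : A.IsHermitian) (c : ℝ) (L : (ι → ℂ) →ₗ[ℂ] (κ → ℂ))
    (hL : ∀ x, L x = 0 → c * (star x ⬝ᵥ A *ᵥ x).re ≤ 0) :
    Nat.card {i // 0 < c * hA.eigenvalues i} ≤ Fintype.card κ := by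
  classical
  by_contra! hlt
  -- The common kernel of L and M is ker L intersected with the span of the eigenvectors counted; by
  -- dimension it is nonzero, yet the form times c is positive on the latter away from 0.
  let M : (ι → ℂ) →ₗ[ℂ] ({i // ¬ 0 < c * hA.eigenvalues i} → ℂ) := LinearMap.pi fun i =>
    dotProductBilin ℂ ℂ (star (hA.eigenvectorBasis i : ι → ℂ))
  have hker : LinearMap.ker (L.prod M) ≠ ⊥ := by
    refine LinearMap.ker_ne_bot_of_finrank_lt ?_
    have := Fintype.card_subtype_compl fun i => 0 < c * hA.eigenvalues i
    have := Fintype.card_subtype_le fun i => 0 < c * hA.eigenvalues i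
    rw [Nat.card_eq_fintype_card] at hlt
    simp only [Module.finrank_prod, Module.finrank_fintype_fun_eq_card]
    omega
  obtain ⟨x, hx, hx0⟩ := (Submodule.ne_bot_iff _).mp hker
  obtain ⟨hx1, hx2⟩ := Prod.mk.inj (LinearMap.mem_ker.mp hx)
  have hq := hL x hx1
  rw [dotProduct_mulVec_eq_sum (apply_eq_sum_eigenvalues hA), Complex.ofReal_re,
    Finset.mul_sum] at hq
  have hnonneg : ∀ k, 0 ≤ c * (hA.eigenvalues k *
      ‖star (hA.eigenvectorBasis k : ι → ℂ) ⬝ᵥ x‖ ^ 2) := by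
    intro k
    by_cases hk : 0 < c * hA.eigenvalues k
    · rw [← mul_assoc]; positivity
    · have : star (hA.eigenvectorBasis k : ι → ℂ) ⬝ᵥ x = 0 := congrFun hx2 ⟨k, hk⟩
      simp [this]
  have hzero := (Finset.sum_eq_zero_iff_of_nonneg fun k _ => hnonneg k).mp
    (le_antisymm hq (Finset.sum_nonneg fun k _ => hnonneg k))
  have horth : ∀ k, star (hA.eigenvectorBasis k : ι → ℂ) ⬝ᵥ x = 0 := by
    intro k
    by_cases hk : 0 < c * hA.eigenvalues k
    · have := hzero k (Finset.mem_univ k)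
      rw [← mul_assoc] at this
      simpa using (mul_eq_zero.mp this).resolve_left hk.ne'
    · exact congrFun hx2 ⟨k, hk⟩
  refine hx0 ?_
  have : hA.eigenvectorBasis.repr (WithLp.toLp 2 x) = 0 := by
    ext k
    rw [OrthonormalBasis.repr_apply_apply, EuclideanSpace.inner_eq_star_dotProduct,
      dotProduct_comm]
    exact horth k
  simpa using this

/-! ### Signature of 2∑|f_i|² - |g|². -/

section Signature

variable {n m : ℕ} {ι : Type*} [Fintype ι]

/-- The polynomial `2 * ∑ i, |f i| ^ 2 - |g| ^ 2`. -/
noncomputable def twiceSumSub (f : ι → MvPolynomial (Fin n) ℂ) (g : MvPolynomial (Fin n) ℂ) :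
    Poly n :=
  C 2 * ∑ i, hermProd (f i) (f i) - hermProd g g

theorem diagEval_twiceSumSub (f : ι → MvPolynomial (Fin n) ℂ) (g : MvPolynomial (Fin n) ℂ)
    (z : Fin n → ℂ) : diagEval (twiceSumSub f g) z =
      ((2 * ∑ i, ‖eval z (f i)‖ ^ 2 - ‖eval z g‖ ^ 2 : ℝ) : ℂ) := by
  have h2 : ∀ p : MvPolynomial (Fin n) ℂ, eval (Sum.elim z fun j => conj (z j)) (hermProd p p) =
      ((‖eval z p‖ ^ 2 : ℝ) : ℂ) := fun p => diagEval_hermProd_self p z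
  simp only [diagEval, twiceSumSub, map_sub, map_mul, map_sum, h2, eval_C]
  push_cast
  rfl

theorem isReal_twiceSumSub (f : ι → MvPolynomial (Fin n) ℂ) (g : MvPolynomial (Fin n) ℂ) :
    IsReal (twiceSumSub f g) := fun z => by
  rw [diagEval_twiceSumSub, Complex.ofReal_im]

theorem coeff_twiceSumSub (f : ι → MvPolynomial (Fin n) ℂ) (g : MvPolynomial (Fin n) ℂ)
    (s t : Fin n →₀ ℕ) : coeff (s.sumElim t) (twiceSumSub f g) =
      2 * ∑ i, coeff s (f i) * conj (coeff t (f i)) - coeff s g * conj (coeff t g) := by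
  simp only [twiceSumSub, coeff_sub, coeff_C_mul, coeff_sum, coeff_hermProd]

theorem isBihomogeneous_twiceSumSub {f : ι → MvPolynomial (Fin n) ℂ} {g : MvPolynomial (Fin n) ℂ}
    (hf : ∀ i, (f i).IsHomogeneous m) (hg : g.IsHomogeneous m) :
    IsBihomogeneous (twiceSumSub f g) m := by
  intro u hu
  obtain ⟨s, t, rfl⟩ := exists_eq_sumElim u
  rw [mem_support_iff, coeff_twiceSumSub] at hu
  simp only [Finsupp.sumElim_inl, Finsupp.sumElim_inr, ← Finsupp.degree_eq_sum]
  constructor <;> by_contra h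
  · exact hu (by simp [(hf _).coeff_eq_zero h, hg.coeff_eq_zero h])
  · exact hu (by simp [(hf _).coeff_eq_zero h, hg.coeff_eq_zero h])

open scoped Matrix in
theorem dotProduct_coeffMatrix_twiceSumSub (f : ι → MvPolynomial (Fin n) ℂ)
    (g : MvPolynomial (Fin n) ℂ) (x : MultiIndex n m → ℂ) :
    (star x ⬝ᵥ coeffMatrix (twiceSumSub f g) m *ᵥ x).re =
      2 * ∑ i, ‖star (fun α : MultiIndex n m => coeff α.1 (f i)) ⬝ᵥ x‖ ^ 2 -
        ‖star (fun α : MultiIndex n m => coeff α.1 g) ⬝ᵥ x‖ ^ 2 := by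
  rw [dotProduct_mulVec_eq_sum (κ := Option ι) (d := fun k => k.elim (-1) fun _ => 2)
    (v := fun k α => k.elim (coeff α.1 g) fun i => coeff α.1 (f i)), Complex.ofReal_re,
    Fintype.sum_option, Finset.mul_sum]
  · simp only [Option.elim]
    ring
  · intro α β
    rw [Fintype.sum_option]
    simp only [Option.elim, ← Finset.mul_sum]
    refine (coeff_twiceSumSub f g α.1 β.1).trans ?_
    push_cast
    ring

-- The form is nonpositive where all the f_i pair to zero and nonnegative where g does, which bounds
-- both indices. The monomial z^t occurs only in g, so its diagonal entry is negative and a negative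
-- eigenvalue exists. An upper bound on P suffices, so the f_i need not be independent.
open scoped ComplexOrder in
theorem exists_signature_twiceSumSub (f : ι → MvPolynomial (Fin n) ℂ)
    {g : MvPolynomial (Fin n) ℂ} (hg : g.IsHomogeneous m)
    {t : Fin n →₀ ℕ} (hft : ∀ i, coeff t (f i) = 0) (hgt : coeff t g ≠ 0) :
    ∃ P ≤ Fintype.card ι,
      signature (coeffMatrix_isHermitian (isReal_twiceSumSub f g) m) = (P, 1) := by
  set hA := coeffMatrix_isHermitian (isReal_twiceSumSub f g) m with hAdef
  refine ⟨_, ?_, Prod.ext rfl (le_antisymm ?_ ?_)⟩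
  · let L : (MultiIndex n m → ℂ) →ₗ[ℂ] (ι → ℂ) := LinearMap.pi fun i =>
      dotProductBilin ℂ ℂ (star fun α : MultiIndex n m => coeff α.1 (f i))
    have := card_pos_eigenvalues_le hA 1 L fun x hx => by
      have h0 : ∀ i, star (fun α : MultiIndex n m => coeff α.1 (f i)) ⬝ᵥ x = 0 :=
        fun i => congrFun hx i
      rw [dotProduct_coeffMatrix_twiceSumSub]
      simp [h0]
    simp only [one_mul] at this
    exact this
  · let L : (MultiIndex n m → ℂ) →ₗ[ℂ] (Unit → ℂ) := LinearMap.pi fun _ =>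
      dotProductBilin ℂ ℂ (star fun α : MultiIndex n m => coeff α.1 g)
    have := card_pos_eigenvalues_le hA (-1) L fun x hx => by
      have h0 : star (fun α : MultiIndex n m => coeff α.1 g) ⬝ᵥ x = 0 := congrFun hx ()
      rw [dotProduct_coeffMatrix_twiceSumSub, h0]
      simp only [norm_zero, ne_eq, OfNat.ofNat_ne_zero, not_false_eq_true, zero_pow, sub_zero,
        neg_mul, one_mul, Left.neg_nonpos_iff]
      positivity
    simp only [neg_mul, one_mul, Left.neg_pos_iff, Fintype.card_unit] at this
    exact this
  · rw [Nat.one_le_iff_ne_zero]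
    refine Nat.card_ne_zero.mpr ⟨?_, inferInstance⟩
    by_contra hempty
    have hpsd := hA.posSemidef_iff_eigenvalues_nonneg.mpr fun i => by
      by_contra h
      exact hempty ⟨i, not_le.mp h⟩
    have ht : ∑ j, t j = m := by
      by_contra h
      exact hgt (hg.coeff_eq_zero (by rwa [Finsupp.degree_eq_sum]))
    have hd := hpsd.diag_nonneg (i := ⟨t, Finset.mem_finsuppAntidiag.mpr ⟨ht, by simp⟩⟩)
    have hc : coeffMatrix (twiceSumSub f g) m ⟨t, Finset.mem_finsuppAntidiag.mpr ⟨ht, by simp⟩⟩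
        ⟨t, Finset.mem_finsuppAntidiag.mpr ⟨ht, by simp⟩⟩ = ((-(‖coeff t g‖ ^ 2) : ℝ) : ℂ) := by
      rw [coeffMatrix, Matrix.of_apply, coeff_twiceSumSub]
      simp [hft, Complex.mul_conj, Complex.normSq_eq_norm_sq]
    rw [hc] at hd
    have := (Complex.zero_le_real.mp hd)
    have := pow_pos (norm_pos_iff.mpr hgt) 2
    linarith

end Signature

/-! ### Squared norms are closed under sums and products. -/

section SquaredNorm

variable {n : ℕ}

theorem isSquaredNorm_of_fintype {κ : Type*} [Fintype κ] (h : κ → MvPolynomial (Fin n) ℂ) :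
    IsSquaredNorm fun z => ∑ k, eval z (h k) * conj (eval z (h k)) := by
  refine ⟨Fintype.card κ, h ∘ (Fintype.equivFin κ).symm, fun z => ?_⟩
  rw [Complex.ofReal_sum]
  refine ((Fintype.equivFin κ).symm.sum_comp _).symm.trans ?_
  refine Finset.sum_congr rfl fun k _ => ?_
  rw [Complex.mul_conj, Complex.normSq_eq_norm_sq]
  rfl

theorem isSquaredNorm_eval (p : MvPolynomial (Fin n) ℂ) :
    IsSquaredNorm fun z => eval z p * conj (eval z p) := by
  simpa using isSquaredNorm_of_fintype fun _ : Unit => p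

theorem IsSquaredNorm.exists_eq {F : (Fin n → ℂ) → ℂ} (hF : IsSquaredNorm F) :
    ∃ (ρ : ℕ) (h : Fin ρ → MvPolynomial (Fin n) ℂ),
      F = fun z => ∑ k, eval z (h k) * conj (eval z (h k)) := by
  obtain ⟨ρ, h, hh⟩ := hF
  refine ⟨ρ, h, funext fun z => ?_⟩
  rw [hh, Complex.ofReal_sum]
  simp only [Complex.mul_conj, Complex.normSq_eq_norm_sq]

theorem IsSquaredNorm.add {F G : (Fin n → ℂ) → ℂ} (hF : IsSquaredNorm F) (hG : IsSquaredNorm G) :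
    IsSquaredNorm (F + G) := by
  obtain ⟨ρ, f, rfl⟩ := hF.exists_eq
  obtain ⟨τ, g, rfl⟩ := hG.exists_eq
  convert isSquaredNorm_of_fintype (Sum.elim f g) using 2 with z
  simp

theorem IsSquaredNorm.mul {F G : (Fin n → ℂ) → ℂ} (hF : IsSquaredNorm F) (hG : IsSquaredNorm G) :
    IsSquaredNorm (F * G) := by
  obtain ⟨ρ, f, rfl⟩ := hF.exists_eq
  obtain ⟨τ, g, rfl⟩ := hG.exists_eq
  convert isSquaredNorm_of_fintype (fun k : Fin ρ × Fin τ => f k.1 * g k.2) using 2 with z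
  rw [Pi.mul_apply, Finset.sum_mul_sum, Fintype.sum_prod_type]
  simp only [map_mul]
  exact Finset.sum_congr rfl fun _ _ => Finset.sum_congr rfl fun _ _ => by ring

end SquaredNorm

/-! ### The example in 4 + k variables. -/

section Witness

variable (k : ℕ)

/-- The forms `x³, xy², x(ax + by)` and `wᵢxy` in the variables `x, y, a, b, w₁, …, w_k`. -/
noncomputable def witnessForms : Fin 3 ⊕ Fin k → MvPolynomial (Fin (4 + k)) ℂ :=
  Sum.elim
    ![X (Fin.castAdd k 0) ^ 3, X (Fin.castAdd k 0) * X (Fin.castAdd k 1) ^ 2,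
      X (Fin.castAdd k 0) * (X (Fin.castAdd k 2) * X (Fin.castAdd k 0) +
        X (Fin.castAdd k 3) * X (Fin.castAdd k 1))]
    fun i => X (Fin.natAdd 4 i) * X (Fin.castAdd k 0) * X (Fin.castAdd k 1)

/-- The form `x²y`. -/
noncomputable def witnessForm : MvPolynomial (Fin (4 + k)) ℂ :=
  X (Fin.castAdd k 0) ^ 2 * X (Fin.castAdd k 1)

theorem isHomogeneous_witnessForms (i : Fin 3 ⊕ Fin k) : (witnessForms k i).IsHomogeneous 3 := by
  have hX : ∀ j : Fin (4 + k), (X j : MvPolynomial (Fin (4 + k)) ℂ).IsHomogeneous 1 :=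
    fun j => isHomogeneous_X _ _
  rcases i with i | i
  · fin_cases i
    · exact (hX _).pow 3
    · exact (hX _).mul ((hX _).pow 2)
    · exact (hX _).mul (((hX _).mul (hX _)).add ((hX _).mul (hX _)))
  · exact ((hX _).mul (hX _)).mul (hX _)

theorem isHomogeneous_witnessForm : (witnessForm k).IsHomogeneous 3 :=
  ((isHomogeneous_X _ _).pow 2).mul (isHomogeneous_X _ _)

theorem coeff_witnessForms (i : Fin 3 ⊕ Fin k) :
    coeff (Finsupp.single (Fin.castAdd k 0) 2 + Finsupp.single (Fin.castAdd k 1) 1)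
      (witnessForms k i) = 0 := by
  have hne : ∀ (s t : Fin (4 + k) →₀ ℕ) (j : Fin (4 + k)), s j ≠ t j → s ≠ t :=
    fun s t j h e => h (by rw [e])
  rcases i with i | i
  · fin_cases i
    · simp only [witnessForms, X, monomial_mul, monomial_pow, Sum.elim_inl, Fin.zero_eta,
        Matrix.cons_val_zero, coeff_monomial]
      exact if_neg (hne _ _ (Fin.castAdd k 0) (by simp [Fin.ext_iff]))
    · simp only [witnessForms, X, monomial_mul, monomial_pow, Sum.elim_inl, Fin.mk_one,
        Matrix.cons_val_one, Matrix.cons_val_zero, coeff_monomial]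
      exact if_neg (hne _ _ (Fin.castAdd k 0) (by simp [Fin.ext_iff]))
    · simp only [witnessForms, X, monomial_mul, monomial_pow, Sum.elim_inl, Fin.reduceFinMk,
        Matrix.cons_val, coeff_monomial, mul_add, coeff_add]
      rw [if_neg (hne _ _ (Fin.castAdd k 2) (by simp [Fin.ext_iff])),
        if_neg (hne _ _ (Fin.castAdd k 3) (by simp [Fin.ext_iff])), add_zero]
  · simp only [witnessForms, X, monomial_mul, Sum.elim_inr, coeff_monomial]
    exact if_neg (hne _ _ (Fin.natAdd 4 i) (by
      simp [Finsupp.single_apply, Fin.ext_iff]))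

theorem coeff_witnessForm :
    coeff (Finsupp.single (Fin.castAdd k 0) 2 + Finsupp.single (Fin.castAdd k 1) 1)
      (witnessForm k) ≠ 0 := by
  simp [witnessForm, X, monomial_mul, monomial_pow, coeff_monomial]

theorem isSquaredNorm_witness : IsSquaredNorm fun z =>
    diagEval (twiceSumSub (witnessForms k) (witnessForm k)) z * ((∑ j, ‖z j‖ ^ 2 : ℝ) : ℂ) := by
  let N (p : MvPolynomial (Fin (4 + k)) ℂ) (z : Fin (4 + k) → ℂ) : ℂ := eval z p * conj (eval z p)
  let T (z : Fin (4 + k) → ℂ) : ℂ :=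
    ∑ i, eval z (X (Fin.natAdd 4 i)) * conj (eval z (X (Fin.natAdd 4 i)))
  let f := witnessForms k
  let x : MvPolynomial (Fin (4 + k)) ℂ := X (Fin.castAdd k 0)
  let y : MvPolynomial (Fin (4 + k)) ℂ := X (Fin.castAdd k 1)
  let a : MvPolynomial (Fin (4 + k)) ℂ := X (Fin.castAdd k 2)
  let b : MvPolynomial (Fin (4 + k)) ℂ := X (Fin.castAdd k 3)
  have hN : ∀ p, IsSquaredNorm (N p) := isSquaredNorm_eval
  have hT : IsSquaredNorm T := isSquaredNorm_of_fintype _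
  have hx := hN x
  have hy := hN y
  have ha := (hN a).add (hN a)
  have hb := (hN b).add (hN b)
  have hTT := hT.add hT
  -- The first two squares are the |u+v|² left over from ag and bg. The other terms collect what
  -- remains of 2∑|f_i|²‖z‖²: one copy each of |y·x³|², |x·xy²|² and |x·w_i xy|² has cancelled
  -- |xg|², |yg|² and |w_i g|².
  have key := (((((hN (y * f (Sum.inl 2) + b * f (Sum.inl 1))).add
    (hN (x * f (Sum.inl 2) + a * f (Sum.inl 0)))).add
    ((hN (f (Sum.inl 0))).mul ((((hx.add hx).add hy).add hb).add hTT))).add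
    ((hN (f (Sum.inl 1))).mul ((((hy.add hy).add hx).add ha).add hTT))).add
    ((hN (f (Sum.inl 2))).mul ((ha.add hb).add hTT))).add
    ((hT.mul (hx.mul hy)).mul ((((hx.add (hy.add hy)).add ha).add hb).add hTT))
  convert key using 2 with z
  rw [diagEval_twiceSumSub, Fintype.sum_sum_type, Fin.sum_univ_three, Fin.sum_univ_add,
    Fin.sum_univ_four]
  have hnorm : ∀ w : ℂ, ((‖w‖ ^ 2 : ℝ) : ℂ) = w * conj w := fun w => by
    rw [Complex.mul_conj, Complex.normSq_eq_norm_sq]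
  have hW : ∀ i, ((‖eval z (witnessForms k (Sum.inr i))‖ ^ 2 : ℝ) : ℂ) =
      eval z (X (Fin.natAdd 4 i)) * conj (eval z (X (Fin.natAdd 4 i))) * (N x z * N y z) := by
    intro i
    rw [hnorm]
    simp only [witnessForms, Sum.elim_inr, map_mul, N, x, y]
    ring
  have hTz : ∑ i, ((‖z (Fin.natAdd 4 i)‖ ^ 2 : ℝ) : ℂ) = T z :=
    Finset.sum_congr rfl fun i _ => by rw [eval_X, hnorm]
  simp only [Complex.ofReal_mul, Complex.ofReal_add, Complex.ofReal_sub, Complex.ofReal_sum, hW,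
    hTz, ← Finset.sum_mul]
  rw [show ∑ i, eval z (X (Fin.natAdd 4 i)) * conj (eval z (X (Fin.natAdd 4 i))) = T z from rfl]
  simp only [hnorm, Pi.add_apply, Pi.mul_apply, N, f, x,
    y, a, b, witnessForms, witnessForm, Sum.elim_inl, Matrix.cons_val, map_add, map_mul, map_pow,
    eval_X, Complex.ofReal_ofNat]
  ring

end Witness

end HermitianSOS

theorem mainTheorem1 :
    (∀ (n m P : ℕ) (r : HermitianSOS.Poly n) (hr : HermitianSOS.IsReal r),
      HermitianSOS.IsBihomogeneous r m →
      HermitianSOS.signature (HermitianSOS.coeffMatrix_isHermitian hr m) = (P, 1) →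
      HermitianSOS.IsSquaredNorm
        (fun z => HermitianSOS.diagEval r z * ((∑ j, ‖z j‖ ^ 2 : ℝ) : ℂ)) →
      n ≤ 3 → n ≤ P) ∧
    (∀ n : ℕ, 4 ≤ n →
      ∃ (m P : ℕ) (r : HermitianSOS.Poly n) (hr : HermitianSOS.IsReal r),
        HermitianSOS.IsBihomogeneous r m ∧
        HermitianSOS.signature (HermitianSOS.coeffMatrix_isHermitian hr m) = (P, 1) ∧
        HermitianSOS.IsSquaredNorm
          (fun z => HermitianSOS.diagEval r z * ((∑ j, ‖z j‖ ^ 2 : ℝ) : ℂ)) ∧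
        P < n) := by
  refine ⟨fun n m P r hr hb hsig hsq hn =>
    HermitianSOS.le_of_isSquaredNorm_mul hr hb hsig hsq hn, fun n hn => ?_⟩
  obtain ⟨k, rfl⟩ := Nat.exists_eq_add_of_le hn
  obtain ⟨P, hP, hsig⟩ := HermitianSOS.exists_signature_twiceSumSub (HermitianSOS.witnessForms k)
    (HermitianSOS.isHomogeneous_witnessForm k) (HermitianSOS.coeff_witnessForms k)
    (HermitianSOS.coeff_witnessForm k)
  refine ⟨3, P, _, HermitianSOS.isReal_twiceSumSub _ _, HermitianSOS.isBihomogeneous_twiceSumSub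
    (HermitianSOS.isHomogeneous_witnessForms k) (HermitianSOS.isHomogeneous_witnessForm k), hsig,
    HermitianSOS.isSquaredNorm_witness k, ?_⟩
  simp only [Fintype.card_sum, Fintype.card_fin] at hP
  omega
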